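/- Let $\Gamma$ be a finite distance-regular graph (undirected, connected, without loops or multiple edges) with vertex set $X$, path-length distance $\partial$, diameter $D \ge 3$ and valency $k \ge 3$. For $x \in X$ put $\Gamma_i(x)=\{y\in X : \partial(x,y)=i\}$, let $A_i\in \mathrm{Mat}_X(\mathbb R)$ $(0\le i\le D)$ be the $i$th distance matrix, and let $M=\mathrm{Span}\{A_0,\dots,A_D\}$ be the Bose–Mesner algebra. Let $J$ be the all-ones matrix. The primitive idempotents of $\Gamma$ are the elements of the basis $\{E_i\}_{i=0}^D$ of $M$ with $E_0=|X|^{-1}J$, $\sum_i E_i=I$, $E_i^t=E_i$, $E_iE_j=\delta_{i,j}E_i$. The Krein parameters $q^h_{i,j}$ of an ordering $\{E_i\}_{i=0}^D$ are defined by $E_i\circ E_j=|X|^{-1}\sum_{h=0}^D q^h_{i,j}E_h$, where $\circ$ is the entrywise product. The ordering is $Q$-polynomial if for $0\le h,i,j\le D$ we have $q^h_{i,j}=0$ whenever one of $h,i,j$ is greater than the sum of the other two, and $q^h_{i,j}\ne 0$ whenever one of $h,i,j$ is equal to the sum of the other two. A primitive idempotent $E$ is $Q$-polynomial if $E=E_1$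 for a $Q$-polynomial ordering $\{E_i\}_{i=0}^D$; writing $a^*_i=q^i_{1,i}$ for this ordering, $E$ is dual-bipartite if $a^*_i=0$ for $0\le i\le D$, and almost dual-bipartite if $a^*_i=0$ for $0\le i\le D-1$ and $a^*_D\neq 0$. For $x\in X$ let $\hat x\in\mathbb R^X$ be the standard basis vector at $x$, and for $u,v\in E\,\mathbb R^X$ let $u\star v=E(u\circ v)$ (the Norton product), where $\circ$ is again the entrywise product. Let $E$ be a $Q$-polynomial primitive idempotent of $\Gamma$ that is dual-bipartite or almost dual-bipartite. Then the set $\{E\hat x : x\in X\}$ is strongly balanced, that is, for all $x,y\in X$ and $0\le i,j\le D$, $$\sum_{z\in\Gamma_i(x)\cap\Gamma_j(y)}E\hat z\in \mathrm{Span}\{E\hat x,E\hat y\},$$ and it is Norton-balanced, that is, for all $x,y\in X$ and $0\le i,j\le D$, $$\sum_{z\in\Gamma_i(x)\cap\Gamma_j(y)}E\hat z\in \mathrm{Span}\{E\hat x,E\hat y,E\hat x\star E\hat y\}.$$ -/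

import Mathlib

open scoped Matrix

/-- The sphere `Γ_i(x)`: the vertices at distance `i` from `x`. -/
noncomputable def sphere {X : Type*} [Fintype X] (Γ : SimpleGraph X) (i : ℕ) (x : X) : Finset X :=
  Finset.univ.filter fun y => Γ.dist x y = i

/-- A finite connected graph is distance-regular if for `i, j ≤ D` (the diameter) the number
`|Γ_i(x) ∩ Γ_j(y)|` depends on `x, y` only through their distance. -/
structure IsDistanceRegular {X : Type*} [Fintype X] [DecidableEq X] (Γ : SimpleGraph X) :
    Prop where
  connected : Γ.Connected
  card_eq : ∀ i ≤ Γ.diam, ∀ j ≤ Γ.diam, ∀ x y x' y' : X, Γ.dist x y = Γ.dist x' y' →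
    (sphere Γ i x ∩ sphere Γ j y).card = (sphere Γ i x' ∩ sphere Γ j y').card

/-- The `i`-th distance matrix `A_i`. -/
noncomputable def distanceMatrix {X : Type*} (Γ : SimpleGraph X) (i : ℕ) : Matrix X X ℝ :=
  Matrix.of fun x y => if Γ.dist x y = i then 1 else 0

/-- The (vector space underlying the) Bose-Mesner algebra: the span of `A_0, …, A_D`. -/
noncomputable def boseMesner {X : Type*} (Γ : SimpleGraph X) : Submodule ℝ (Matrix X X ℝ) :=
  Submodule.span ℝ (Set.range fun i : Fin (Γ.diam + 1) => distanceMatrix Γ i)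

/-- `E 0, …, E D` is an ordering of the primitive idempotents of `Γ`, the trivial one
`|X|⁻¹ J` coming first. -/
structure IsPrimitiveIdempotentOrdering {X : Type*} [Fintype X] [DecidableEq X]
    (Γ : SimpleGraph X) (E : Fin (Γ.diam + 1) → Matrix X X ℝ) : Prop where
  linearIndependent : LinearIndependent ℝ E
  span_eq : Submodule.span ℝ (Set.range E) = boseMesner Γ
  trivial_eq : E 0 = (Fintype.card X : ℝ)⁻¹ • Matrix.of fun _ _ => (1 : ℝ)
  sum_eq_one : ∑ i, E i = 1
  transpose_eq : ∀ i, (E i)ᵀ = E i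
  mul_eq : ∀ i j, E i * E j = if i = j then E i else 0

/-- The scalars `q h i j` are the Krein parameters `q^h_{i,j}` of the ordering `E`:
`E_i ∘ E_j = |X|⁻¹ ∑_h q^h_{i,j} E_h`, with the entrywise product on the left. -/
def IsKreinParameters {X : Type*} [Fintype X] {n : ℕ} (E : Fin n → Matrix X X ℝ)
    (q : Fin n → Fin n → Fin n → ℝ) : Prop :=
  ∀ i j, E i ⊙ E j = (Fintype.card X : ℝ)⁻¹ • ∑ h, q h i j • E h

/-- `E` is a `Q`-polynomial ordering of the primitive idempotents of `Γ`, and `q` is its array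
of Krein parameters (`q h i j` is `q^h_{i,j}`). -/
structure IsQPolynomialOrdering {X : Type*} [Fintype X] [DecidableEq X]
    (Γ : SimpleGraph X) (E : Fin (Γ.diam + 1) → Matrix X X ℝ)
    (q : Fin (Γ.diam + 1) → Fin (Γ.diam + 1) → Fin (Γ.diam + 1) → ℝ) : Prop where
  ordering : IsPrimitiveIdempotentOrdering Γ E
  krein : IsKreinParameters E q
  eq_zero : ∀ h i j : Fin (Γ.diam + 1),
    ((i : ℕ) + j < h ∨ (h : ℕ) + j < i ∨ (h : ℕ) + i < j) → q h i j = 0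
  ne_zero : ∀ h i j : Fin (Γ.diam + 1),
    ((h : ℕ) = i + j ∨ (i : ℕ) = h + j ∨ (j : ℕ) = h + i) → q h i j ≠ 0

/-- `F` is a `Q`-polynomial primitive idempotent: `F = E_1` for some `Q`-polynomial ordering. -/
def IsQPolynomialIdempotent {X : Type*} [Fintype X] [DecidableEq X]
    (Γ : SimpleGraph X) (F : Matrix X X ℝ) : Prop :=
  ∃ E q, IsQPolynomialOrdering Γ E q ∧ E 1 = F

/-- `F = E_1` for a `Q`-polynomial ordering with `a*_i = q^i_{1,i} = 0` for `0 ≤ i ≤ D`. -/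
def IsDualBipartite {X : Type*} [Fintype X] [DecidableEq X]
    (Γ : SimpleGraph X) (F : Matrix X X ℝ) : Prop :=
  ∃ E q, IsQPolynomialOrdering Γ E q ∧ E 1 = F ∧ ∀ i, q i 1 i = 0

/-- `F = E_1` for a `Q`-polynomial ordering with `a*_i = q^i_{1,i} = 0` for `0 ≤ i ≤ D - 1` and
`a*_D ≠ 0`. -/
def IsAlmostDualBipartite {X : Type*} [Fintype X] [DecidableEq X]
    (Γ : SimpleGraph X) (F : Matrix X X ℝ) : Prop :=
  ∃ E q, IsQPolynomialOrdering Γ E q ∧ E 1 = F ∧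
    (∀ i : Fin (Γ.diam + 1), (i : ℕ) < Γ.diam → q i 1 i = 0) ∧
    q (Fin.last Γ.diam) 1 (Fin.last Γ.diam) ≠ 0

/-- The vector `F x̂`, where `x̂` is the standard basis vector at `x`. -/
def projVertex {X : Type*} [Fintype X] [DecidableEq X] (F : Matrix X X ℝ) (x : X) : X → ℝ :=
  F *ᵥ Pi.single x 1

/-- The Norton product `u ⋆ v = F (u ∘ v)`, with `∘` the entrywise product; it is used for
`u, v` in the column space `F V`. -/
def nortonProduct {X : Type*} [Fintype X] (F : Matrix X X ℝ) (u v : X → ℝ) : X → ℝ :=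
  F *ᵥ fun z => u z * v z

/-- The set `{F x̂ : x ∈ X}` is strongly balanced. -/
def IsStronglyBalanced {X : Type*} [Fintype X] [DecidableEq X]
    (Γ : SimpleGraph X) (F : Matrix X X ℝ) : Prop :=
  ∀ x y : X, ∀ i ≤ Γ.diam, ∀ j ≤ Γ.diam,
    ∑ z ∈ sphere Γ i x ∩ sphere Γ j y, projVertex F z ∈
      Submodule.span ℝ {projVertex F x, projVertex F y}

/-- The set `{F x̂ : x ∈ X}` is Norton-balanced. -/
def IsNortonBalanced {X : Type*} [Fintype X] [DecidableEq X]
    (Γ : SimpleGraph X) (F : Matrix X X ℝ) : Prop :=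
  ∀ x y : X, ∀ i ≤ Γ.diam, ∀ j ≤ Γ.diam,
    ∑ z ∈ sphere Γ i x ∩ sphere Γ j y, projVertex F z ∈
      Submodule.span ℝ {projVertex F x, projVertex F y,
        nortonProduct F (projVertex F x) (projVertex F y)}

/-!
Write `E₀, …, E_D` for a `Q`-polynomial ordering with `E₁ = E`, and put
`T_{ij} = E₁ (E_i x̂ ∘ E_j ŷ)`. The sum of `E ẑ` over `z ∈ Γ_i(x) ∩ Γ_j(y)` is
`E₁ (A_i x̂ ∘ A_j ŷ)`, and the `A_i` are linear combinations of the `E_i`; so strong balance follows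
once every `T_{ij}` lies in `W = Span {E x̂, E ŷ}`.

Two facts give this. First, `T_{ij} = 0` whenever the Krein parameter `q^1_{i,j}` vanishes
(`mulVec_hadamard_eq_zero`): the sum of squares of the coordinates of `T_{ij}`, over all `x` and `y`,
is the sum of the entries of `E₁ ∘ E_i ∘ E_j`, a multiple of that parameter. Hence `T_{ij} = 0` if
`|i - j| > 1`, and also `T_{ii} = 0` for `i < D`, since `a*_i = 0` there. Second, each row sum
`∑_j T_{ij} = E₁ (E_i x̂ ∘ ŷ)` is a multiple of `E ŷ` (`sum_mulVec_hadamard`). By induction on `i`,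
all terms of row `i` but one are known to lie in `W`: those with `j < i` by the induction hypothesis
with the roles of `x` and `y` exchanged, the others because they vanish. The exceptional term is
`j = i + 1` if `i < D`, and `j = D` if `i = D`, and the row sum places it in `W` too
(`mulVec_hadamard_mem_span`).

The Norton-balanced condition asks for membership in a larger span.
-/

/-- The sum of the entries of `E_h ∘ E_i ∘ E_j` is `|X|⁻¹ q^h_{i,j} tr E_h`; this is stated for
vanishing Krein parameters only. -/
lemma sum_entries_eq_zero_of_krein {X : Type*} [Fintype X] [DecidableEq X] {Γ : SimpleGraph X}
    {E : Fin (Γ.diam + 1) → Matrix X X ℝ}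
    {q : Fin (Γ.diam + 1) → Fin (Γ.diam + 1) → Fin (Γ.diam + 1) → ℝ}
    (hE : IsPrimitiveIdempotentOrdering Γ E) (hq : IsKreinParameters E q)
    {h i j : Fin (Γ.diam + 1)} (h0 : q h i j = 0) :
    ∑ z, ∑ w, E h z w * E i z w * E j z w = 0 := by
  -- Distinct idempotents are orthogonal for the trace form, the sum of entrywise products.
  have orth : ∀ l, l ≠ h → ∑ z, ∑ w, E h z w * E l z w = 0 := fun l hl => by
    have hT : ∀ z w, E l z w = E l w z := fun z w => congrFun (congrFun (hE.transpose_eq l) w) z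
    have hz : ∀ z, ∑ w, E h z w * E l z w = (E h * E l) z z := fun z => by
      simp only [Matrix.mul_apply, hT z]
    simp [hz, hE.mul_eq, hl.symm]
  have hk : ∀ z w, E i z w * E j z w = (Fintype.card X : ℝ)⁻¹ * ∑ l, q l i j * E l z w :=
    fun z w => by
      have := congrFun (congrFun (hq i j) z) w
      simpa [Matrix.sum_apply] using this
  have hterm : ∀ z w, E h z w * E i z w * E j z w =
      ∑ l, (Fintype.card X : ℝ)⁻¹ * q l i j * (E h z w * E l z w) := fun z w => by
    rw [mul_assoc, hk, Finset.mul_sum, Finset.mul_sum]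
    exact Finset.sum_congr rfl fun l _ => by ring
  have hcomm : ∑ z, ∑ w, E h z w * E i z w * E j z w =
      ∑ l, (Fintype.card X : ℝ)⁻¹ * q l i j * ∑ z, ∑ w, E h z w * E l z w := by
    simp only [hterm, Finset.mul_sum]
    rw [Finset.sum_congr rfl fun z _ => Finset.sum_comm, Finset.sum_comm]
  rw [hcomm]
  refine Finset.sum_eq_zero fun l _ => ?_
  by_cases hl : l = h
  · simp [hl, h0]
  · simp [orth l hl]

/-- For symmetric idempotents, `∑_{x,y} ‖P (Q x̂ ∘ R ŷ)‖²` is the sum of the entries of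
`P ∘ Q ∘ R`; so if that sum vanishes, every `P (Q x̂ ∘ R ŷ)` does. -/
lemma mulVec_hadamard_eq_zero {X : Type*} [Fintype X] {P Q R : Matrix X X ℝ}
    (hP : Pᵀ = P) (hQ : Qᵀ = Q) (hR : Rᵀ = R)
    (hP2 : P * P = P) (hQ2 : Q * Q = Q) (hR2 : R * R = R)
    (h0 : ∑ z, ∑ w, P z w * Q z w * R z w = 0) (x y : X) :
    P *ᵥ (fun z => Q z x * R z y) = 0 := by
  have key : ∀ {M : Matrix X X ℝ}, M * M = M → Mᵀ = M → ∀ z w,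
      ∑ x, M z x * M w x = M z w := fun {M} hM hMt z w => by
    conv_rhs => rw [← hM, Matrix.mul_apply]
    exact Finset.sum_congr rfl fun x _ => by rw [← congrFun (congrFun hMt w) x]; rfl
  have hPs : ∀ u z, P u z = P z u := fun u z => congrFun (congrFun hP z) u
  have hsq : ∑ u, ∑ x, ∑ y, (∑ z, P u z * (Q z x * R z y)) ^ 2 = 0 := by
    rw [← h0]
    have e1 : ∀ z w, P z w * Q z w * R z w = ∑ u, ∑ x, ∑ y,
        (P u z * (Q z x * R z y)) * (P u w * (Q w x * R w y)) := fun z w => by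
      rw [← key hP2 hP z w, ← key hQ2 hQ z w, ← key hR2 hR z w, Finset.sum_mul_sum,
        Finset.sum_mul]
      refine Finset.sum_congr rfl fun u _ => ?_
      rw [Finset.sum_mul_sum]
      refine Finset.sum_congr rfl fun x _ => Finset.sum_congr rfl fun y _ => ?_
      rw [hPs u z, hPs u w]; ring
    simp only [e1, sq, Finset.sum_mul_sum]
    simp only [← Fintype.sum_prod_type']
    let e : (X × X × X × X × X) ≃ (X × X × X × X × X) :=
      ⟨fun p => (p.2.2.2.1, p.2.2.2.2, p.1, p.2.1, p.2.2.1),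
       fun p => (p.2.2.1, p.2.2.2.1, p.2.2.2.2, p.1, p.2.1), fun _ => rfl, fun _ => rfl⟩
    exact Fintype.sum_equiv e _ _ fun _ => rfl
  ext u
  have h1 := (Finset.sum_eq_zero_iff_of_nonneg fun u _ => Finset.sum_nonneg fun x _ =>
    Finset.sum_nonneg fun y _ => sq_nonneg _).1 hsq u (Finset.mem_univ u)
  have h2 := (Finset.sum_eq_zero_iff_of_nonneg fun x _ =>
    Finset.sum_nonneg fun y _ => sq_nonneg _).1 h1 x (Finset.mem_univ x)
  have h3 := (Finset.sum_eq_zero_iff_of_nonneg fun y _ => sq_nonneg _).1 h2 y (Finset.mem_univ y)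
  exact pow_eq_zero_iff two_ne_zero |>.1 h3

lemma sum_mulVec_hadamard {X ι : Type*} [Fintype X] [DecidableEq X] [Fintype ι]
    {E : ι → Matrix X X ℝ} (hE : ∑ j, E j = 1) (F Q : Matrix X X ℝ) (x y : X) :
    ∑ j, F *ᵥ (fun z => Q z x * E j z y) = Q y x • projVertex F y := by
  rw [projVertex, ← Matrix.mulVec_smul, ← Matrix.mulVec_sum]
  congr 1
  ext z
  have hz : ∑ j, E j z y = (1 : Matrix X X ℝ) z y := by rw [← hE, Matrix.sum_apply]
  rw [Finset.sum_apply, ← Finset.mul_sum, hz]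
  by_cases hzy : z = y
  · subst hzy; simp
  · simp [hzy]

/-- The vectors `E₁ (E_i x̂ ∘ E_j ŷ)` lie in `Span {E₁ x̂, E₁ ŷ}` if `a*_i = 0` for `i < D`. There is
no condition on `a*_D`, which treats the dual-bipartite and almost dual-bipartite cases together. -/
lemma mulVec_hadamard_mem_span {X : Type*} [Fintype X] [DecidableEq X] {Γ : SimpleGraph X}
    {E : Fin (Γ.diam + 1) → Matrix X X ℝ}
    {q : Fin (Γ.diam + 1) → Fin (Γ.diam + 1) → Fin (Γ.diam + 1) → ℝ}
    (hE : IsQPolynomialOrdering Γ E q) (hD : 0 < Γ.diam)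
    (ha : ∀ i : Fin (Γ.diam + 1), (i : ℕ) < Γ.diam → q i 1 i = 0)
    (i j : Fin (Γ.diam + 1)) (x y : X) :
    E 1 *ᵥ (fun z => E i z x * E j z y) ∈
      Submodule.span ℝ {projVertex (E 1) x, projVertex (E 1) y} := by
  have h1 : ((1 : Fin (Γ.diam + 1)) : ℕ) = 1 := by
    rw [Fin.val_one', Nat.mod_eq_of_lt (by omega)]
  have hO := hE.ordering
  have hidem : ∀ i, E i * E i = E i := fun i => by simp [hO.mul_eq]
  have vanish : ∀ i j, ∑ z, ∑ w, E 1 z w * E i z w * E j z w = 0 → ∀ x y,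
      E 1 *ᵥ (fun z => E i z x * E j z y) = 0 := fun i j h0 =>
    mulVec_hadamard_eq_zero (hO.transpose_eq _) (hO.transpose_eq _) (hO.transpose_eq _)
      (hidem _) (hidem _) (hidem _) h0
  have far : ∀ i j : Fin (Γ.diam + 1), (i : ℕ) + 1 < j → ∀ x y,
      E 1 *ᵥ (fun z => E i z x * E j z y) = 0 := fun i j hij =>
    vanish i j (sum_entries_eq_zero_of_krein hO hE.krein
      (hE.eq_zero 1 i j (by rw [h1]; omega)))
  have diag : ∀ i : Fin (Γ.diam + 1), (i : ℕ) < Γ.diam → ∀ x y,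
      E 1 *ᵥ (fun z => E i z x * E i z y) = 0 := fun i hi => by
    refine vanish i i ?_
    -- The hypothesis is on `q^i_{1,i}` and not on `q^1_{i,i}`; the triple sum is symmetric.
    rw [← sum_entries_eq_zero_of_krein hO hE.krein (ha i hi)]
    exact Finset.sum_congr rfl fun z _ => Finset.sum_congr rfl fun w _ => by ring
  induction hn : (i : ℕ) using Nat.strong_induction_on generalizing i j x y with
  | _ n ih =>
  subst hn
  set W := Submodule.span ℝ {projVertex (E 1) x, projVertex (E 1) y} with hW
  -- The one column that the row sum is needed for: `i + 1`, or `D` if `i = D`.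
  obtain ⟨j₀, hj₀⟩ : ∃ j₀ : Fin (Γ.diam + 1), (j₀ : ℕ) = min ((i : ℕ) + 1) Γ.diam :=
    ⟨⟨min ((i : ℕ) + 1) Γ.diam, by omega⟩, rfl⟩
  have others : ∀ j, j ≠ j₀ → E 1 *ᵥ (fun z => E i z x * E j z y) ∈ W := fun j hj => by
    have hj' : (j : ℕ) ≠ j₀ := fun h => hj (Fin.ext h)
    rcases lt_trichotomy (j : ℕ) i with h | h | h
    · have := ih j h j i y x rfl
      rw [Set.pair_comm, ← hW] at this
      simpa only [mul_comm] using this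
    · obtain rfl := Fin.ext h
      rw [diag j (by omega)]
      exact W.zero_mem
    · rw [far i j (by omega)]
      exact W.zero_mem
  by_cases hj : j = j₀
  · have hsum := sum_mulVec_hadamard hO.sum_eq_one (E 1) (E i) x y
    rw [← Finset.add_sum_erase _ _ (Finset.mem_univ j)] at hsum
    rw [eq_sub_of_add_eq hsum]
    refine W.sub_mem (W.smul_mem _ (Submodule.subset_span (by simp))) (W.sum_mem fun l hl => ?_)
    exact others l fun h => (Finset.ne_of_mem_erase hl) (h.trans hj.symm)
  · exact others j hj

lemma sum_projVertex_sphere_inter {X : Type*} [Fintype X] [DecidableEq X] (Γ : SimpleGraph X)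
    (F : Matrix X X ℝ) (x y : X) (i j : ℕ) :
    ∑ z ∈ sphere Γ i x ∩ sphere Γ j y, projVertex F z =
      F *ᵥ fun z => distanceMatrix Γ i z x * distanceMatrix Γ j z y := by
  ext w
  simp only [projVertex, Finset.sum_apply, Matrix.mulVec_single_one, Matrix.mulVec, dotProduct,
    distanceMatrix, Matrix.of_apply, Matrix.col_apply]
  have hs : sphere Γ i x ∩ sphere Γ j y =
      Finset.univ.filter fun z => Γ.dist z x = i ∧ Γ.dist z y = j := by
    ext z
    simp [sphere, SimpleGraph.dist_comm]
  rw [hs, Finset.sum_filter]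
  refine Finset.sum_congr rfl fun z _ => ?_
  by_cases h1 : Γ.dist z x = i <;> by_cases h2 : Γ.dist z y = j <;> simp [h1, h2]

/-- Membership of `F (B x̂ ∘ C ŷ)` in a subspace passes from generators `B`, `C` to their span. -/
lemma mulVec_hadamard_mem_of_mem_span {X ι : Type*} [Fintype X] {E : ι → Matrix X X ℝ}
    {F : Matrix X X ℝ} {W : Submodule ℝ (X → ℝ)} {x y : X}
    (h : ∀ i j, F *ᵥ (fun z => E i z x * E j z y) ∈ W) {B C : Matrix X X ℝ}
    (hB : B ∈ Submodule.span ℝ (Set.range E)) (hC : C ∈ Submodule.span ℝ (Set.range E)) :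
    F *ᵥ (fun z => B z x * C z y) ∈ W := by
  induction hB using Submodule.span_induction with
  | mem B hB =>
    obtain ⟨i, rfl⟩ := hB
    induction hC using Submodule.span_induction with
    | mem C hC =>
      obtain ⟨j, rfl⟩ := hC
      exact h i j
    | zero => simp [← Pi.zero_def]
    | add C C' _ _ hC hC' =>
      convert W.add_mem hC hC' using 1
      rw [← Matrix.mulVec_add]
      congr 1
      ext z
      simp [mul_add]
    | smul c C _ hC =>
      convert W.smul_mem c hC using 1
      rw [← Matrix.mulVec_smul]
      congr 1
      ext z
      simp [mul_left_comm]
  | zero => simp [← Pi.zero_def]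
  | add B B' _ _ hB hB' =>
    convert W.add_mem hB hB' using 1
    rw [← Matrix.mulVec_add]
    congr 1
    ext z
    simp [add_mul]
  | smul c B _ hB =>
    convert W.smul_mem c hB using 1
    rw [← Matrix.mulVec_smul]
    congr 1
    ext z
    simp [mul_assoc]

theorem mainTheorem3 {X : Type*} [Fintype X] [DecidableEq X]
    (Γ : SimpleGraph X) [DecidableRel Γ.Adj] (hΓ : IsDistanceRegular Γ)
    (hD : 3 ≤ Γ.diam) (k : ℕ) (hreg : Γ.IsRegularOfDegree k) (hk : 3 ≤ k)
    (E : Matrix X X ℝ) (hE : IsQPolynomialIdempotent Γ E)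
    (hdual : IsDualBipartite Γ E ∨ IsAlmostDualBipartite Γ E) :
    IsStronglyBalanced Γ E ∧ IsNortonBalanced Γ E := by
  obtain ⟨e, q, hQ, rfl, ha⟩ : ∃ e q, IsQPolynomialOrdering Γ e q ∧ e 1 = E ∧
      ∀ i : Fin (Γ.diam + 1), (i : ℕ) < Γ.diam → q i 1 i = 0 := by
    rcases hdual with ⟨e, q, hQ, h1, h⟩ | ⟨e, q, hQ, h1, h, -⟩
    · exact ⟨e, q, hQ, h1, fun i _ => h i⟩
    · exact ⟨e, q, hQ, h1, h⟩
  have strong : IsStronglyBalanced Γ (e 1) := fun x y i hi j hj => by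
    have hA : ∀ i ≤ Γ.diam, distanceMatrix Γ i ∈ Submodule.span ℝ (Set.range e) := fun i hi => by
      rw [hQ.ordering.span_eq]
      exact Submodule.subset_span ⟨⟨i, Nat.lt_succ_of_le hi⟩, rfl⟩
    rw [sum_projVertex_sphere_inter]
    exact mulVec_hadamard_mem_of_mem_span
      (fun i j => mulVec_hadamard_mem_span hQ (by omega) ha i j x y) (hA i hi) (hA j hj)
  refine ⟨strong, fun x y i hi j hj => Submodule.span_mono ?_ (strong x y i hi j hj)⟩
  exact Set.insert_subset_insert (Set.singleton_subset_iff.2 (Set.mem_insert _ _))
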